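/- A weight function is a continuous nondecreasing $\omega:[0,\infty)\to[0,\infty)$ with $\omega(0)=0$ and $\lim_{t\to\infty}\omega(t)=\infty$; it is normalized if $\omega=0$ on $[0,1]$. Condition $(\omega_3)$ means $\log t=o(\omega(t))$ as $t\to\infty$, and $(\omega_4)$ means that $\varphi_\omega(t):=\omega(e^t)$ is convex on $\mathbb{R}$. The growth index $\gamma(\omega)\in[0,\infty]$ is the supremum of all $\gamma>0$ for which there is $K>1$ with $\limsup_{t\to\infty}\omega(K^\gamma t)/\omega(t)<K$ (and $0$ if there is no such $\gamma$). For a normalized weight function $\omega$ with $(\omega_3)$ put $\varphi^*_\omega(s):=\sup_{y\in\mathbb{R}}\{sy-\varphi_\omega(y)\}$, $s\ge 0$. For a sequence $M$ of positive reals with $M_0=1$ put $\omega_M(0):=0$ and $\omega_M(t):=\sup_{p\in\mathbb{N}}\log(t^p/M_p)$ for $t>0$. Let $\mathcal{R}$ be the Riemann surface of the logarithm and $S=\{z\in\mathcal{R}: a<\arg z<b\}$, with $a<b$ real, an (unbounded) sector. For a sequence $M$ of positive reals let $\mathcal{A}^{M}(S)$ be the space of the holomorphic functions $f$ on $S$ with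 $\|f\|_M:=\sup_{z\in S,\,p\in\mathbb{N}}|f^{(p)}(z)|/M_p<\infty$, normed by $\|\cdot\|_M$. Put $\mathcal{A}_{\{M\}}(S):=\bigcup_{h>0}\mathcal{A}^{(h^pM_p)_p}(S)$; for a family $\mathcal{M}=\{M^x:x>0\}$ of such sequences that is pointwise nondecreasing in $x$ put $\mathcal{A}_{\{\mathcal{M}\}}(S):=\bigcup_{x>0}\mathcal{A}_{\{M^x\}}(S)$; and for a normalized weight function $\omega$ with $(\omega_3)$ put $\mathcal{A}_{\{\omega\}}(S):=\bigcup_{l>0}\mathcal{A}^{W^l}(S)$, where $W^l_p:=\exp(\tfrac1l\varphi^*_\omega(lp))$. Each union carries the locally convex inductive limit topology, i.e. the finest locally convex vector space topology making all the inclusions continuous. The spaces $\Lambda_{\{\mathcal{M}\}}$ and $\Lambda_{\{\omega\}}$ of complex sequences $(a_p)_p$ are defined in the same way, with $\sup_{p}|a_p|/M_p$ in place of $\|f\|_M$. **Theorem.** Let $\tau$ be a normalized weight function with $(\omega_3)$, $(\omega_4)$ and $\gamma(\tau)>0$. For $x>0$ let $T^x_p:=\exp(\tfrac1x\varphi^*_\tau(xp))$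 and $\widehat T^x:=(p!\,T^x_p)_{p\in\mathbb{N}}$, and let $\widehat{\mathcal T}:=\{\widehat T^x:x>0\}$. Then for every $x>0$ the function $\omega:=\omega_{\widehat T^x}$ is finite-valued and is a normalized weight function satisfying $(\omega_3)$, $(\omega_4)$ and $\gamma(\omega)=\gamma(\tau)+1>1$ (with $\infty+1=\infty$). Moreover, for every $x>0$ and every sector $S$, $$\mathcal{A}_{\{\widehat{\mathcal T}\}}(S)=\mathcal{A}_{\{\omega_{\widehat T^x}\}}(S)\quad\text{and}\quad \Lambda_{\{\widehat{\mathcal T}\}}=\Lambda_{\{\omega_{\widehat T^x}\}}$$ as locally convex vector spaces, i.e. the two sides have the same elements and the same topology. -/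

import Mathlib

open Filter Topology Asymptotics

open scoped ENNReal Nat

noncomputable section

/-! ### Weight functions -/

/-- A weight function `ω : [0, ∞) → [0, ∞)`: continuous, nondecreasing, `ω 0 = 0`, `ω → ∞`.
Functions on `[0, ∞)` are represented by functions on `ℝ` whose values at negative arguments
are never used. -/
structure IsWeightFunction (ω : ℝ → ℝ) : Prop where
  continuousOn : ContinuousOn ω (Set.Ici 0)
  monotoneOn : MonotoneOn ω (Set.Ici 0)
  map_zero : ω 0 = 0
  tendsto_atTop : Tendsto ω atTop atTop

/-- A normalized weight function: moreover `ω = 0` on `[0, 1]`. -/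
structure IsNormalizedWeight (ω : ℝ → ℝ) : Prop extends IsWeightFunction ω where
  eq_zero : ∀ t ∈ Set.Icc (0 : ℝ) 1, ω t = 0

/-- Condition `(ω₃)`: `log t = o(ω t)` as `t → ∞`. -/
def Omega3 (ω : ℝ → ℝ) : Prop :=
  Real.log =o[atTop] ω

/-- Condition `(ω₄)`: `φ_ω : t ↦ ω (exp t)` is convex on `ℝ`. -/
def Omega4 (ω : ℝ → ℝ) : Prop :=
  ConvexOn ℝ Set.univ (fun t : ℝ => ω (Real.exp t))

/-- The property `(P_{ω,γ})`: there is `K > 1` with `limsup_{t → ∞} ω (K ^ γ t) / ω t < K`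
(the upper limit is taken in `[-∞, ∞]`). -/
def GrowthProperty (ω : ℝ → ℝ) (γ : ℝ) : Prop :=
  ∃ K : ℝ, 1 < K ∧
    limsup (fun t : ℝ => ((ω (K ^ γ * t) / ω t : ℝ) : EReal)) atTop < (K : EReal)

/-- The growth index `γ(ω) = sup {γ > 0 : (P_{ω,γ})}`, an element of `[0, ∞]`
(it is `0` if no `γ > 0` is admissible). -/
def gammaIndex (ω : ℝ → ℝ) : ℝ≥0∞ :=
  ⨆ (γ : ℝ) (_ : 0 < γ) (_ : GrowthProperty ω γ), ENNReal.ofReal γ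

/-- The Legendre–Fenchel–Young conjugate `φ*_ω (x) = sup_{y ∈ ℝ} (x y - ω (exp y))`, `x ≥ 0`;
the supremum is finite for a normalized weight with `(ω₃)`, see `bddAbove_youngConj`. -/
def youngConj (ω : ℝ → ℝ) (x : ℝ) : ℝ :=
  ⨆ y : ℝ, (x * y - ω (Real.exp y))

/-! ### Weight sequences and weight matrices -/

/-- The positive real numbers. -/
abbrev PosReal : Type := {r : ℝ // 0 < r}

/-- A weight sequence: a sequence of positive real numbers. -/
abbrev WeightSeq : Type := ℕ → PosReal

/-- The matrix associated with `ω`: `W^l_p = exp (φ*_ω (l p) / l)`. -/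
def weightMatrix (ω : ℝ → ℝ) (l : PosReal) : WeightSeq :=
  fun p => ⟨Real.exp (1 / (l : ℝ) * youngConj ω (l * p)), Real.exp_pos _⟩

/-- Multiplication of a weight sequence by the factorials: `p ↦ p! M_p`. -/
def factorialMul (M : WeightSeq) : WeightSeq :=
  fun p => ⟨(p ! : ℝ) * M p, mul_pos (by exact_mod_cast Nat.factorial_pos p) (M p).2⟩

/-- The matrix `T̂ = {T̂^x}` with `T̂^x_p = p! T^x_p`, where `T^x_p = exp (φ*_τ (x p) / x)`. -/
def hatMatrix (τ : ℝ → ℝ) (x : PosReal) : WeightSeq :=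
  factorialMul (weightMatrix τ x)

/-- The associated function `ω_M t = sup_p log (t ^ p / M_p)` for `t > 0`, and `ω_M 0 = 0`. -/
def assocFun (M : WeightSeq) (t : ℝ) : ℝ :=
  if t = 0 then 0 else ⨆ p : ℕ, Real.log (t ^ p / M p)

/-! ### Locally convex subspaces and their inductive limits -/

/-- A linear subspace of a complex vector space `V`, together with a locally convex vector space
topology on it. Two of them are equal if they have the same elements and the same topology. -/
structure LCSubspace (V : Type*) [AddCommGroup V] [Module ℂ V] where
  carrier : Submodule ℂ V
  [topology : TopologicalSpace carrier]
  [isTopologicalAddGroup : IsTopologicalAddGroup carrier]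
  [continuousSMul : ContinuousSMul ℂ carrier]
  [locallyConvexSpace : LocallyConvexSpace ℝ carrier]

attribute [instance] LCSubspace.topology LCSubspace.isTopologicalAddGroup
  LCSubspace.continuousSMul LCSubspace.locallyConvexSpace

section InductiveLimit

variable {V : Type*} [AddCommGroup V] [Module ℂ V] {κ : Type*}

/-- The vector space topologies on `⨆ k, E k` which are locally convex and for which all the
inclusions `E k → ⨆ k, E k` are continuous. -/
def admissibleTopologies (E : κ → LCSubspace V) :
    Set (TopologicalSpace ↥(⨆ k, (E k).carrier)) :=
  {t | @IsTopologicalAddGroup _ t _ ∧ @ContinuousSMul ℂ _ _ _ t ∧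
    @LocallyConvexSpace ℝ _ _ _ _ _ t ∧
    ∀ k, @Continuous _ _ (E k).topology t
      (Submodule.inclusion (le_iSup (fun j => (E j).carrier) k))}

/-- The locally convex inductive limit of a family of locally convex subspaces: the space they
generate (their union, if the family is directed, see `mem_indLim`), with the finest locally
convex topology for which all the inclusions are continuous. -/
def indLim (E : κ → LCSubspace V) : LCSubspace V where
  carrier := ⨆ k, (E k).carrier
  topology := sInf (admissibleTopologies E)
  isTopologicalAddGroup := topologicalAddGroup_sInf fun _ ht => ht.1
  continuousSMul := continuousSMul_sInf fun _ ht => ht.2.1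
  locallyConvexSpace := LocallyConvexSpace.sInf fun _ ht => ht.2.2.1

theorem mem_indLim [Nonempty κ] (E : κ → LCSubspace V)
    (hE : Directed (· ≤ ·) fun k => (E k).carrier) (f : V) :
    f ∈ (indLim E).carrier ↔ ∃ k, f ∈ (E k).carrier :=
  Submodule.mem_iSup_of_directed _ hE

end InductiveLimit

/-! ### Spaces of Roumieu type

The function classes and the sequence classes are treated at once: an element `f` of a vector
space `V` has "derivatives" `D z p f` of order `p : ℕ` at the points `z`, depending linearly
on `f`. -/

section Roumieu

variable {V : Type*} [AddCommGroup V] [Module ℂ V] {ι : Type*}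

/-- The `f` with `sup_{z, p} |D z p f| / M_p < ∞`. -/
def boundedSubmodule (D : ι → ℕ → V →ₗ[ℂ] ℂ) (M : WeightSeq) : Submodule ℂ V where
  carrier := {f | BddAbove (Set.range fun i : ι × ℕ => ‖D i.1 i.2 f‖ / M i.2)}
  zero_mem' := ⟨0, by rintro _ ⟨i, rfl⟩; simp⟩
  add_mem' := by
    rintro f g ⟨A, hA⟩ ⟨B, hB⟩
    refine ⟨A + B, ?_⟩
    rintro _ ⟨i, rfl⟩
    have h1 := hA ⟨i, rfl⟩
    have h2 := hB ⟨i, rfl⟩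
    have h3 : ‖D i.1 i.2 (f + g)‖ / (M i.2 : ℝ)
        ≤ ‖D i.1 i.2 f‖ / (M i.2 : ℝ) + ‖D i.1 i.2 g‖ / (M i.2 : ℝ) := by
      rw [← add_div, map_add]
      exact div_le_div_of_nonneg_right (norm_add_le _ _) (M i.2).2.le
    exact h3.trans (add_le_add h1 h2)
  smul_mem' := by
    rintro c f ⟨A, hA⟩
    refine ⟨‖c‖ * A, ?_⟩
    rintro _ ⟨i, rfl⟩
    have h1 := hA ⟨i, rfl⟩
    simp only [map_smul, smul_eq_mul, norm_mul, mul_div_assoc]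
    exact mul_le_mul_of_nonneg_left h1 (norm_nonneg c)

/-- The norm `sup_{z, p} |D z p f| / M_p`. -/
def supNorm (D : ι → ℕ → V →ₗ[ℂ] ℂ) (M : WeightSeq) :
    Seminorm ℂ (boundedSubmodule D M) :=
  Seminorm.of (fun f => ⨆ i : ι × ℕ, ‖D i.1 i.2 f‖ / M i.2)
    (by
      intro f g
      refine Real.iSup_le (fun i => ?_) (add_nonneg
        (Real.iSup_nonneg fun i => div_nonneg (norm_nonneg _) (M i.2).2.le)
        (Real.iSup_nonneg fun i => div_nonneg (norm_nonneg _) (M i.2).2.le))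
      refine le_trans ?_ (add_le_add (le_ciSup f.2 i) (le_ciSup g.2 i))
      rw [← add_div, Submodule.coe_add, map_add]
      exact div_le_div_of_nonneg_right (norm_add_le _ _) (M i.2).2.le)
    (by
      intro c f
      rw [Real.mul_iSup_of_nonneg (norm_nonneg c)]
      simp only [Submodule.coe_smul, map_smul, smul_eq_mul, norm_mul, mul_div_assoc])

/-- The space of all `f` with `sup_{z, p} |D z p f| / M_p < ∞`, with the topology of that norm. -/
def normedStep (D : ι → ℕ → V →ₗ[ℂ] ℂ) (M : WeightSeq) : LCSubspace V :=
  let q : SeminormFamily ℂ (boundedSubmodule D M) Unit := fun _ => supNorm D M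
  letI t : TopologicalSpace (boundedSubmodule D M) := q.moduleFilterBasis.topology
  have hq : WithSeminorms q := ⟨rfl⟩
  { carrier := boundedSubmodule D M
    topology := t
    isTopologicalAddGroup := hq.topologicalAddGroup
    continuousSMul := hq.continuousSMul
    locallyConvexSpace := hq.toLocallyConvexSpace }

/-- The class `{M}`: inductive limit over `h > 0` of the normed spaces with norm
`sup_{z, p} |D z p f| / (h ^ p M_p)`. -/
def seqClass (D : ι → ℕ → V →ₗ[ℂ] ℂ) (M : WeightSeq) : LCSubspace V :=
  indLim fun h : PosReal => normedStep D fun p => h ^ p * M p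

/-- The class `{𝓜}` of a weight matrix: inductive limit over `x > 0` of the classes `{M^x}`. -/
def matrixClass (D : ι → ℕ → V →ₗ[ℂ] ℂ) (M : PosReal → WeightSeq) : LCSubspace V :=
  indLim fun x : PosReal => seqClass D (M x)

/-- The class `{ω}` of a weight function: inductive limit over `l > 0` of the normed spaces with
norm `sup_{z, p} |D z p f| / exp (φ*_ω (l p) / l)`. -/
def weightClass (D : ι → ℕ → V →ₗ[ℂ] ℂ) (ω : ℝ → ℝ) : LCSubspace V :=
  indLim fun l : PosReal => normedStep D (weightMatrix ω l)

end Roumieu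

/-! ### Holomorphic functions on sectors of the Riemann surface of the logarithm

The Riemann surface of the logarithm is the covering `exp : ℂ → ℂ \ {0}`: the number `w` stands
for the point over `z = exp w` with modulus `exp (Re w)` and argument `Im w ∈ ℝ`. -/

/-- The unbounded sector `{z : a < arg z < b}` of the Riemann surface of the logarithm. -/
def sector (a b : ℝ) : Set ℂ :=
  {w | a < w.im ∧ w.im < b}

theorem isOpen_sector (a b : ℝ) : IsOpen (sector a b) :=
  (isOpen_lt continuous_const Complex.continuous_im).inter
    (isOpen_lt Complex.continuous_im continuous_const)

/-- Extension of a function on `S` by zero. -/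
def zeroExt {S : Set ℂ} (f : S → ℂ) : ℂ → ℂ :=
  Function.extend Subtype.val f 0

theorem zeroExt_apply {S : Set ℂ} (f : S → ℂ) (w : S) : zeroExt f w = f w :=
  Subtype.val_injective.extend_apply f 0 w

theorem zeroExt_add {S : Set ℂ} (f g : S → ℂ) : zeroExt (f + g) = zeroExt f + zeroExt g := by
  funext w
  by_cases hw : w ∈ S
  · simpa using (zeroExt_apply (f + g) ⟨w, hw⟩).trans
      (congrArg₂ (· + ·) (zeroExt_apply f ⟨w, hw⟩) (zeroExt_apply g ⟨w, hw⟩)).symm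
  · have hw' : ¬ ∃ v : S, (v : ℂ) = w := by rintro ⟨v, rfl⟩; exact hw v.2
    simp [zeroExt, Function.extend_apply' _ _ _ hw']

theorem zeroExt_smul {S : Set ℂ} (c : ℂ) (f : S → ℂ) : zeroExt (c • f) = c • zeroExt f := by
  funext w
  by_cases hw : w ∈ S
  · simpa using (zeroExt_apply (c • f) ⟨w, hw⟩).trans
      (congrArg (c * ·) (zeroExt_apply f ⟨w, hw⟩)).symm
  · have hw' : ¬ ∃ v : S, (v : ℂ) = w := by rintro ⟨v, rfl⟩; exact hw v.2
    simp [zeroExt, Function.extend_apply' _ _ _ hw']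

theorem zeroExt_zero {S : Set ℂ} : zeroExt (0 : S → ℂ) = 0 := by
  simpa using zeroExt_smul (S := S) 0 0

/-- The vector space `𝓗(S)` of holomorphic functions on the sector `S = {a < arg z < b}`. -/
def holo (a b : ℝ) : Submodule ℂ (sector a b → ℂ) where
  carrier := {f | DifferentiableOn ℂ (zeroExt f) (sector a b)}
  zero_mem' := by
    rw [Set.mem_ofPred_eq, zeroExt_zero]
    exact differentiableOn_const 0
  add_mem' := by
    intro f g hf hg
    rw [Set.mem_ofPred_eq, zeroExt_add]
    exact DifferentiableOn.add hf hg
  smul_mem' := by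
    intro c f hf
    rw [Set.mem_ofPred_eq, zeroExt_smul]
    exact DifferentiableOn.const_smul hf c

/-- The derivative `f' = df/dz` on a sector; in the logarithmic coordinate `z = exp w` it is
`exp (-w) df/dw`. -/
def holoDeriv (a b : ℝ) : holo a b →ₗ[ℂ] holo a b where
  toFun f := ⟨fun w => Complex.exp (-w) * deriv (zeroExt f.1) w, by
    have h : DifferentiableOn ℂ (fun w => Complex.exp (-w) * deriv (zeroExt f.1) w)
        (sector a b) :=
      (Complex.differentiable_exp.comp differentiable_neg).differentiableOn.mul
        (DifferentiableOn.deriv f.2 (isOpen_sector a b))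
    exact h.congr fun w hw => zeroExt_apply _ ⟨w, hw⟩⟩
  map_add' := by
    intro f g
    ext w
    have hw := (isOpen_sector a b).mem_nhds w.2
    change Complex.exp (-w) * deriv (zeroExt (f.1 + g.1)) w = _
    rw [zeroExt_add, deriv_add (f.2.differentiableAt hw) (g.2.differentiableAt hw), mul_add]
    rfl
  map_smul' := by
    intro c f
    ext w
    have hw := (isOpen_sector a b).mem_nhds w.2
    change Complex.exp (-w) * deriv (zeroExt (c • f.1)) w = _
    rw [zeroExt_smul, deriv_const_smul c (f.2.differentiableAt hw), smul_eq_mul, mul_left_comm]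
    rfl

/-- The value `f^(p)(z)` of the `p`-th derivative at a point `z` of the sector, as a linear
functional of `f ∈ 𝓗(S)`. -/
def derivAt (a b : ℝ) (z : sector a b) (p : ℕ) : holo a b →ₗ[ℂ] ℂ :=
  LinearMap.proj z ∘ₗ (holo a b).subtype ∘ₗ (holoDeriv a b ^ p)

/-- The ultraholomorphic class `𝓐_{𝓜}(S)` of a weight matrix on `S = {a < arg z < b}`. -/
def ultraholMatrix (a b : ℝ) (M : PosReal → WeightSeq) : LCSubspace (holo a b) :=
  matrixClass (derivAt a b) M

/-- The ultraholomorphic class `𝓐_{ω}(S)` of a weight function on `S = {a < arg z < b}`. -/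
def ultraholWeight (a b : ℝ) (ω : ℝ → ℝ) : LCSubspace (holo a b) :=
  weightClass (derivAt a b) ω

/-- The entries of a sequence, as linear functionals. -/
def entry (_ : Unit) (p : ℕ) : (ℕ → ℂ) →ₗ[ℂ] ℂ :=
  LinearMap.proj p

/-- The sequence class `Λ_{𝓜}` of a weight matrix. -/
def lambdaMatrix (M : PosReal → WeightSeq) : LCSubspace (ℕ → ℂ) :=
  matrixClass entry M

/-- The sequence class `Λ_{ω}` of a weight function. -/
def lambdaWeight (ω : ℝ → ℝ) : LCSubspace (ℕ → ℂ) :=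
  weightClass entry ω

/-! ### The definitions are meaningful: finiteness of the conjugate, directed unions -/

theorem bddAbove_youngConj {ω : ℝ → ℝ} (hω : IsNormalizedWeight ω) (h3 : Omega3 ω) {x : ℝ}
    (hx : 0 ≤ x) : BddAbove (Set.range fun y : ℝ => x * y - ω (Real.exp y)) := by
  have hnn : ∀ t : ℝ, 0 ≤ t → 0 ≤ ω t := fun t ht =>
    hω.map_zero ▸ hω.monotoneOn Set.self_mem_Ici ht ht
  obtain ⟨Y, hY⟩ : ∃ Y : ℝ, ∀ y ≥ Y, x * y ≤ ω (Real.exp y) := by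
    have h := h3.def (c := 1 / (x + 1)) (by positivity)
    obtain ⟨Y, hY⟩ := eventually_atTop.1 (Real.tendsto_exp_atTop.eventually h)
    refine ⟨max Y 0, fun y hy => ?_⟩
    have hy0 : 0 ≤ y := (le_max_right _ _).trans hy
    have := hY y ((le_max_left _ _).trans hy)
    rw [Real.log_exp, Real.norm_of_nonneg hy0, Real.norm_of_nonneg (hnn _ (Real.exp_pos y).le),
      div_mul_eq_mul_div, one_mul, le_div_iff₀ (by positivity)] at this
    nlinarith
  refine ⟨x * |Y|, ?_⟩
  rintro _ ⟨y, rfl⟩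
  have h1 : 0 ≤ ω (Real.exp y) := hnn _ (Real.exp_pos y).le
  have h2 : 0 ≤ x * |Y| := by positivity
  rcases le_total Y y with h | h
  · have := hY y h
    simp only
    linarith
  · have := mul_le_mul_of_nonneg_left (h.trans (le_abs_self Y)) hx
    simp only
    linarith

theorem weightMatrix_mono {ω : ℝ → ℝ} (hω : IsNormalizedWeight ω) (h3 : Omega3 ω)
    {l m : PosReal} (hlm : l ≤ m) (p : ℕ) : weightMatrix ω l p ≤ weightMatrix ω m p := by
  have hl := l.2
  have hm := m.2
  have hlm' : (l : ℝ) ≤ m := hlm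
  refine Subtype.mk_le_mk.2 (Real.exp_le_exp.2 ?_)
  rw [one_div, one_div, inv_mul_le_iff₀ hl]
  refine ciSup_le fun y => ?_
  have hy : 0 ≤ ω (Real.exp y) :=
    hω.map_zero ▸ hω.monotoneOn Set.self_mem_Ici (Real.exp_pos y).le (Real.exp_pos y).le
  have h1 := le_ciSup (bddAbove_youngConj hω h3 (x := m * p) (by positivity)) y
  have h2 : (l : ℝ) * ((m : ℝ)⁻¹ * (m * p * y - ω (Real.exp y)))
      ≤ l * ((m : ℝ)⁻¹ * youngConj ω (m * p)) := by
    gcongr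
    exact h1
  refine le_trans ?_ h2
  have h3' : (l : ℝ) * (m : ℝ)⁻¹ ≤ 1 := by
    rw [← div_eq_mul_inv]
    exact (div_le_one hm).2 hlm'
  have h4 : (l : ℝ) * ((m : ℝ)⁻¹ * (m * p * y - ω (Real.exp y)))
      = l * p * y - l * (m : ℝ)⁻¹ * ω (Real.exp y) := by
    field_simp
  rw [h4]
  nlinarith

section Membership

variable {V : Type*} [AddCommGroup V] [Module ℂ V] {ι : Type*}

theorem boundedSubmodule_mono (D : ι → ℕ → V →ₗ[ℂ] ℂ) {M N : WeightSeq} (h : ∀ p, M p ≤ N p) :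
    boundedSubmodule D M ≤ boundedSubmodule D N := by
  rintro f ⟨A, hA⟩
  refine ⟨A, ?_⟩
  rintro _ ⟨i, rfl⟩
  exact (div_le_div_of_nonneg_left (norm_nonneg _) (M i.2).2 (h i.2)).trans (hA ⟨i, rfl⟩)

theorem mem_seqClass (D : ι → ℕ → V →ₗ[ℂ] ℂ) (M : WeightSeq) (f : V) :
    f ∈ (seqClass D M).carrier ↔
      ∃ h : PosReal, BddAbove (Set.range fun i : ι × ℕ => ‖D i.1 i.2 f‖ / (h ^ i.2 * M i.2 : ℝ)) := by
  have : Nonempty PosReal := ⟨⟨1, one_pos⟩⟩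
  refine mem_indLim _ (Monotone.directed_le fun h k hhk => boundedSubmodule_mono D fun p => ?_) f
  refine Subtype.coe_le_coe.1 ?_
  have h0 := h.2
  have h1 := (M p).2
  have h2 : (h : ℝ) ≤ k := hhk
  change (h : ℝ) ^ p * (M p : ℝ) ≤ (k : ℝ) ^ p * (M p : ℝ)
  gcongr

/-- For a weight matrix which is nondecreasing in its parameter, the class is the union over
`x, h > 0` of the normed spaces. -/
theorem mem_matrixClass (D : ι → ℕ → V →ₗ[ℂ] ℂ) (M : PosReal → WeightSeq)
    (hM : ∀ x y, x ≤ y → ∀ p, M x p ≤ M y p) (f : V) :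
    f ∈ (matrixClass D M).carrier ↔ ∃ x h : PosReal,
      BddAbove (Set.range fun i : ι × ℕ => ‖D i.1 i.2 f‖ / (h ^ i.2 * M x i.2 : ℝ)) := by
  have : Nonempty PosReal := ⟨⟨1, one_pos⟩⟩
  refine (mem_indLim _ (Monotone.directed_le fun x y hxy => ?_) f).trans
    (exists_congr fun x => mem_seqClass D (M x) f)
  refine iSup_mono fun h => boundedSubmodule_mono D fun p => ?_
  exact mul_le_mul_right (hM x y hxy p) _

theorem mem_weightClass (D : ι → ℕ → V →ₗ[ℂ] ℂ) {ω : ℝ → ℝ} (hω : IsNormalizedWeight ω)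
    (h3 : Omega3 ω) (f : V) :
    f ∈ (weightClass D ω).carrier ↔ ∃ l : PosReal, BddAbove (Set.range fun i : ι × ℕ =>
      ‖D i.1 i.2 f‖ / Real.exp (1 / (l : ℝ) * youngConj ω (l * i.2))) := by
  have : Nonempty PosReal := ⟨⟨1, one_pos⟩⟩
  exact mem_indLim _ (Monotone.directed_le fun l m hlm =>
    boundedSubmodule_mono D (weightMatrix_mono hω h3 hlm)) f

end Membership

end

/-! Write ω for `assocFun (hatMatrix τ x)`. Everything rests on comparing ω(t) with the infimum over
r > 0 of t/r + τ(r)/x. The factorial produces t/r, because u^p/p! ≤ e^u for u = t/r, and T^x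
produces τ(r)/x by Young's inequality; so ω(t) ≤ t/r + τ(r)/x for every r (`assocFun_hatMatrix_le`).
Conversely, convexity of φ_τ gives t/r + τ(r)/x ≤ 4ω(t) + 4 for large t and a minimizing r
(`exists_le_assocFun_hatMatrix_of_large`).

Index: passing from (t, r) to (λ^(γ+1) t, λ^γ r) multiplies t/r by λ, so a growth bound of exponent
γ for τ becomes one of exponent γ + 1 for ω. The way back uses that ω(r τ(r)) is comparable to τ(r).

Spaces: conjugating the two bounds gives (l/e)^p T̂^{xl}_p ≤ W^l_p ≤ C (4l)^p T̂^{4xl}_p for the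
matrix W of ω. The classes {M} absorb geometric factors, so every normed step of one side embeds
continuously into a step of the other, and the inductive limits agree. -/

/-! ### Continuous inclusions of locally convex subspaces -/

section ContinuousInclusion

variable {V : Type*} [AddCommGroup V] [Module ℂ V] {κ κ' ι : Type*}

/-- `E` is contained in `F`, and the inclusion is continuous. -/
def ContinuousInclusion (E F : LCSubspace V) : Prop :=
  ∃ h : E.carrier ≤ F.carrier, Continuous (Submodule.inclusion h)

theorem ContinuousInclusion.trans {E F G : LCSubspace V} (h₁ : ContinuousInclusion E F)
    (h₂ : ContinuousInclusion F G) : ContinuousInclusion E G := by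
  obtain ⟨h, hc⟩ := h₁
  obtain ⟨k, kc⟩ := h₂
  exact ⟨h.trans k, kc.comp hc⟩

theorem ContinuousInclusion.antisymm {E F : LCSubspace V} (h₁ : ContinuousInclusion E F)
    (h₂ : ContinuousInclusion F E) : E = F := by
  obtain ⟨h, hc⟩ := h₁
  obtain ⟨k, kc⟩ := h₂
  obtain @⟨A, tA, _, _, _⟩ := E
  obtain @⟨B, tB, _, _, _⟩ := F
  obtain rfl : A = B := le_antisymm h k
  obtain rfl : tA = tB := le_antisymm (continuous_id_iff_le.1 hc) (continuous_id_iff_le.1 kc)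
  rfl

theorem continuousInclusion_indLim (E : κ → LCSubspace V) (k : κ) :
    ContinuousInclusion (E k) (indLim E) :=
  ⟨le_iSup (fun j => (E j).carrier) k, continuous_sInf_rng.2 fun _ ht => ht.2.2.2 k⟩

/-- Universal property of the limit: the topology pulled back from `G` is itself admissible, hence
coarser than the finest admissible one. -/
theorem indLim_continuousInclusion {E : κ → LCSubspace V} {G : LCSubspace V}
    (h : ∀ k, ContinuousInclusion (E k) G) : ContinuousInclusion (indLim E) G := by
  have hle : (⨆ k, (E k).carrier) ≤ G.carrier := iSup_le fun k => (h k).1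
  refine ⟨hle, continuous_sInf_dom
    (t₁ := (admissibleTopologies E : Set (TopologicalSpace ↥(⨆ k, (E k).carrier))))
    (t := G.topology.induced (Submodule.inclusion hle)) ⟨?_, ?_, ?_, fun k => ?_⟩
    continuous_induced_dom⟩
  · exact topologicalAddGroup_induced (Submodule.inclusion hle)
  · exact continuousSMul_induced (Submodule.inclusion hle)
  · exact LocallyConvexSpace.induced ((Submodule.inclusion hle).restrictScalars ℝ)
  · exact continuous_induced_rng.2 (h k).2

/-- An inequality `M ≤ C N` of weight sequences gives a continuous inclusion of normed spaces. -/
theorem normedStep_continuousInclusion (D : ι → ℕ → V →ₗ[ℂ] ℂ) {M N : WeightSeq} {C : ℝ}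
    (h : ∀ p, (M p : ℝ) ≤ C * N p) :
    ContinuousInclusion (normedStep D M) (normedStep D N) := by
  have hC : 0 ≤ C := by
    have h0 := (M 0).2.le.trans (h 0)
    exact nonneg_of_mul_nonneg_left h0 (N 0).2
  have key : ∀ (f : V) (i : ι × ℕ),
      ‖D i.1 i.2 f‖ / (N i.2 : ℝ) ≤ C * (‖D i.1 i.2 f‖ / (M i.2 : ℝ)) := fun f i => by
    rw [← mul_div_assoc, div_le_div_iff₀ (N i.2).2 (M i.2).2]
    have := mul_le_mul_of_nonneg_left (h i.2) (norm_nonneg (D i.1 i.2 f))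
    linarith
  have hle : boundedSubmodule D M ≤ boundedSubmodule D N := by
    rintro f ⟨A, hA⟩
    refine ⟨C * A, ?_⟩
    rintro _ ⟨i, rfl⟩
    exact (key f i).trans (mul_le_mul_of_nonneg_left (hA ⟨i, rfl⟩) hC)
  let _ : TopologicalSpace (boundedSubmodule D M) := (normedStep D M).topology
  let _ : TopologicalSpace (boundedSubmodule D N) := (normedStep D N).topology
  have hM : WithSeminorms fun _ : Unit => supNorm D M := ⟨rfl⟩
  have hN : WithSeminorms fun _ : Unit => supNorm D N := ⟨rfl⟩
  refine ⟨hle, WithSeminorms.continuous_of_isBounded hM hN (Submodule.inclusion hle)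
    (Seminorm.IsBounded.of_real fun _ => ⟨{()}, C, fun f => ?_⟩)⟩
  rw [Finset.sup_singleton]
  refine Real.iSup_le (fun i => (key f i).trans
    (mul_le_mul_of_nonneg_left (le_ciSup f.2 i) hC)) ?_
  exact mul_nonneg hC (Real.iSup_nonneg fun i => div_nonneg (norm_nonneg _) (M i.2).2.le)

/-- The functionals `D` play no role in the comparison, so two inequalities between sequences settle
function spaces and sequence spaces alike. -/
theorem matrixClass_eq_weightClass (D : ι → ℕ → V →ₗ[ℂ] ℂ) (M : PosReal → WeightSeq) (ω : ℝ → ℝ)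
    (h₁ : ∀ x h : PosReal, ∃ (l : PosReal) (C : ℝ), ∀ p,
      (h : ℝ) ^ p * M x p ≤ C * weightMatrix ω l p)
    (h₂ : ∀ l : PosReal, ∃ (x h : PosReal) (C : ℝ), ∀ p,
      (weightMatrix ω l p : ℝ) ≤ C * ((h : ℝ) ^ p * M x p)) :
    matrixClass D M = weightClass D ω := by
  refine ContinuousInclusion.antisymm
    (indLim_continuousInclusion fun x => indLim_continuousInclusion fun h => ?_)
    (indLim_continuousInclusion fun l => ?_)
  · obtain ⟨l, C, hC⟩ := h₁ x h
    exact (normedStep_continuousInclusion D (C := C) hC).trans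
      (continuousInclusion_indLim (fun l => normedStep D (weightMatrix ω l)) l)
  · obtain ⟨x, h, C, hC⟩ := h₂ l
    exact (normedStep_continuousInclusion D (N := fun p => h ^ p * M x p) (C := C) hC).trans
      ((continuousInclusion_indLim (fun h : PosReal => normedStep D fun p => h ^ p * M x p) h).trans
        (continuousInclusion_indLim (fun x => seqClass D (M x)) x))

end ContinuousInclusion

/-! ### The growth index through power bounds -/

/-- `ω (lam ^ γ t) ≤ C lam ω t` for all `lam ≥ 1` and all large `t`. -/
def PowerBound (ω : ℝ → ℝ) (γ : ℝ) : Prop :=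
  ∃ C t₀ : ℝ, ∀ t ≥ t₀, ∀ lam : ℝ, 1 ≤ lam → ω (lam ^ γ * t) ≤ C * (lam * ω t)

/-- Iterating the bound at K gives it at every K^n from the same t₀ on; rounding `lam` up to the
next power of K costs one factor K, which serves as C. -/
theorem GrowthProperty.powerBound {ω : ℝ → ℝ} (hω : IsWeightFunction ω) {γ : ℝ} (hγ : 0 < γ)
    (h : GrowthProperty ω γ) : PowerBound ω γ := by
  obtain ⟨K, hK, hlim⟩ := h
  have hK0 : 0 < K := by linarith
  obtain ⟨t₀, ht₀⟩ := eventually_atTop.1 ((eventually_lt_of_limsup_lt hlim).and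
    ((hω.tendsto_atTop.eventually_gt_atTop 0).and (eventually_ge_atTop 0)))
  have step : ∀ t ≥ t₀, ω (K ^ γ * t) ≤ K * ω t := fun t ht => by
    obtain ⟨h1, h2, -⟩ := ht₀ t ht
    rw [EReal.coe_lt_coe_iff, div_lt_iff₀ h2] at h1
    exact h1.le
  have hKγ : 1 ≤ K ^ γ := Real.one_le_rpow hK.le hγ.le
  have iter : ∀ (n : ℕ), ∀ t ≥ t₀, ω ((K ^ γ) ^ n * t) ≤ K ^ n * ω t := by
    intro n
    induction n with
    | zero => intro t _; simp
    | succ n ih =>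
      intro t ht
      have h0 : 0 ≤ t := (ht₀ t ht).2.2
      have h1 : t₀ ≤ K ^ γ * t := ht.le.trans (le_mul_of_one_le_left h0 hKγ)
      calc ω ((K ^ γ) ^ (n + 1) * t) = ω ((K ^ γ) ^ n * (K ^ γ * t)) := by ring_nf
        _ ≤ K ^ n * ω (K ^ γ * t) := ih _ h1
        _ ≤ K ^ n * (K * ω t) := by gcongr; exact step t ht
        _ = K ^ (n + 1) * ω t := by ring
  refine ⟨K, t₀, fun t ht lam hl => ?_⟩
  obtain ⟨n, hn1, hn2⟩ := exists_nat_pow_near hl hK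
  have h0 : 0 ≤ t := (ht₀ t ht).2.2
  have hω0 := (ht₀ t ht).2.1
  calc ω (lam ^ γ * t) ≤ ω ((K ^ γ) ^ (n + 1) * t) := by
        refine hω.monotoneOn (Set.mem_Ici.2 (by positivity)) (Set.mem_Ici.2 (by positivity)) ?_
        rw [← Real.rpow_natCast, ← Real.rpow_mul hK0.le, mul_comm γ, Real.rpow_mul hK0.le,
          Real.rpow_natCast]
        gcongr
    _ ≤ K ^ (n + 1) * ω t := iter _ t ht
    _ = K * (K ^ n * ω t) := by ring
    _ ≤ K * (lam * ω t) := by gcongr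

theorem PowerBound.growthProperty {ω : ℝ → ℝ} (hω : Tendsto ω atTop atTop) {γ δ : ℝ} (hδ : 0 < δ)
    (hδγ : δ < γ) (h : PowerBound ω γ) : GrowthProperty ω δ := by
  obtain ⟨C, t₀, hC⟩ := h
  have hγ : 0 < γ := hδ.trans hδγ
  have hθ : 0 < 1 - δ / γ := by rw [sub_pos, div_lt_one hγ]; exact hδγ
  -- With lam = K^(δ/γ) the quotient is at most C K^(δ/γ); this is below K once K^(1 - δ/γ) > C,
  -- which is where δ < γ enters.
  obtain ⟨K, hK1, hK⟩ := ((eventually_gt_atTop (1 : ℝ)).and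
    ((tendsto_rpow_atTop hθ).eventually_gt_atTop C)).exists
  have hK0 : 0 < K := by linarith
  have hCK : C * K ^ (δ / γ) < K := by
    have h1 : K ^ (1 - δ / γ) * K ^ (δ / γ) = K := by
      rw [← Real.rpow_add hK0, sub_add_cancel, Real.rpow_one]
    nlinarith [Real.rpow_pos_of_pos hK0 (δ / γ)]
  refine ⟨K, hK1, lt_of_le_of_lt (limsup_le_of_le (a := ((C * K ^ (δ / γ) : ℝ) : EReal))
    (h := ?_)) (EReal.coe_lt_coe_iff.2 hCK)⟩
  filter_upwards [eventually_ge_atTop t₀, hω.eventually_gt_atTop 0] with t ht hpos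
  rw [EReal.coe_le_coe_iff, div_le_iff₀ hpos, mul_assoc]
  have h2 : (K ^ (δ / γ)) ^ γ = K ^ δ := by
    rw [← Real.rpow_mul hK0.le, div_mul_cancel₀ _ hγ.ne']
  rw [← h2]
  exact hC t ht _ (Real.one_le_rpow hK1.le (by positivity))

/-- The arbitrarily small loss of exponent in `PowerBound.growthProperty` does not affect a
supremum. -/
theorem gammaIndex_eq_iSup_powerBound {ω : ℝ → ℝ} (hω : IsWeightFunction ω) :
    gammaIndex ω = ⨆ (γ : ℝ) (_ : 0 < γ) (_ : PowerBound ω γ), ENNReal.ofReal γ := by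
  refine le_antisymm (iSup_mono fun γ => iSup_mono fun hγ => iSup_le fun h =>
    le_iSup_of_le (h.powerBound hω hγ) le_rfl) ?_
  refine iSup_le fun γ => iSup_le fun hγ => iSup_le fun h => le_of_forall_lt fun c hc => ?_
  obtain ⟨d, hcd, hd⟩ := exists_between hc
  have hd' : d ≠ ∞ := ne_top_of_lt hd
  have hd0 : 0 < d.toReal := ENNReal.toReal_pos (ne_zero_of_lt hcd) hd'
  refine hcd.trans_le ?_
  rw [← ENNReal.ofReal_toReal hd']
  refine le_iSup_of_le d.toReal (le_iSup_of_le hd0 (le_iSup_of_le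
    (h.growthProperty hω.tendsto_atTop hd0 ?_) le_rfl))
  exact (ENNReal.lt_ofReal_iff_toReal_lt hd').1 hd

/-! ### Transfer of power bounds between τ and ω -/

section Transfer

variable {ω τ : ℝ → ℝ} {c B t₁ : ℝ}

/-- If `ω t` is comparable to `inf_r (t / r + c τ r)`, a power bound for `τ` gives one for `ω`. -/
theorem PowerBound.add_one (hτ : IsWeightFunction τ) (hc : 0 < c)
    (hB : 0 < B)
    (hU : ∀ t > 0, ∀ r > 0, ω t ≤ t / r + c * τ r)
    (hL : ∀ t ≥ t₁, ∃ r > 0, t / r + c * τ r ≤ B * ω t) {γ : ℝ} (h : PowerBound τ γ) :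
    PowerBound ω (γ + 1) := by
  obtain ⟨C, r₀, hC⟩ := h
  set r₁ := max r₀ 1
  have hr₁ : 0 < r₁ := lt_max_of_lt_right one_pos
  -- Testing the upper bound at q gives B ω(t) < 2Bt/q = t/r₁ for large t. This forces the
  -- near-optimal r to exceed r₁, where the bound for τ is available.
  set q := 2 * B * r₁
  have hq : 0 < q := by positivity
  have hτ0 : ∀ r, 0 < r → 0 ≤ τ r := fun r hr =>
    hτ.map_zero ▸ hτ.monotoneOn Set.self_mem_Ici hr.le hr.le
  refine ⟨max C 1 * B, max (max t₁ 1) (q * (c * τ q) + 1), fun t ht lam hl => ?_⟩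
  have ht1 : t₁ ≤ t := (le_max_left _ _).trans ((le_max_left _ _).trans ht)
  have ht0 : 0 < t := one_pos.trans_le ((le_max_right _ _).trans ((le_max_left _ _).trans ht))
  have htq : q * (c * τ q) < t := by linarith [(le_max_right _ _).trans ht]
  have hl0 : 0 < lam := by linarith
  obtain ⟨r, hr, hrL⟩ := hL t ht1
  have hrr : r₁ ≤ r := by
    have h1 := hU t ht0 q hq
    have h2 : B * ω t < t / r₁ := by
      have h3 : c * τ q < t / q := by rw [lt_div_iff₀ hq]; linarith
      have h4 : B * (t / q + t / q) = t / r₁ := by simp only [q]; field_simp; ring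
      nlinarith
    have h5 : t / r < t / r₁ := by nlinarith [mul_nonneg hc.le (hτ0 r hr)]
    exact ((div_lt_div_iff_of_pos_left ht0 hr hr₁).1 h5).le
  have hlγ : 0 < lam ^ γ := Real.rpow_pos_of_pos hl0 _
  have h6 := hU (lam ^ (γ + 1) * t) (by positivity) (lam ^ γ * r) (by positivity)
  have h7 : lam ^ (γ + 1) * t / (lam ^ γ * r) = lam * (t / r) := by
    rw [Real.rpow_add_one hl0.ne']; field_simp
  have h8 := hC r ((le_max_left _ _).trans hrr) lam hl
  have h9 : τ (lam ^ γ * r) ≤ max C 1 * (lam * τ r) :=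
    h8.trans (mul_le_mul_of_nonneg_right (le_max_left _ _) (mul_nonneg hl0.le (hτ0 r hr)))
  have h10 : lam * (t / r) ≤ max C 1 * (lam * (t / r)) :=
    le_mul_of_one_le_left (by positivity) (le_max_right _ _)
  calc ω (lam ^ (γ + 1) * t) ≤ lam * (t / r) + c * τ (lam ^ γ * r) := h7 ▸ h6
    _ ≤ max C 1 * (lam * (t / r)) + c * (max C 1 * (lam * τ r)) := by gcongr
    _ = max C 1 * lam * (t / r + c * τ r) := by ring
    _ ≤ max C 1 * lam * (B * ω t) := by gcongr
    _ = max C 1 * B * (lam * ω t) := by ring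

/-- Converse to `PowerBound.add_one`. -/
theorem PowerBound.of_add_one (hτ : IsWeightFunction τ) (hc : 0 < c)
    (hB : 0 < B)
    (hU : ∀ t > 0, ∀ r > 0, ω t ≤ t / r + c * τ r)
    (hL : ∀ t ≥ t₁, ∃ r > 0, t / r + c * τ r ≤ B * ω t) {γ : ℝ} (hγ : 0 < γ)
    (h : PowerBound ω (γ + 1)) : PowerBound τ γ := by
  obtain ⟨C, t₀, hC⟩ := h
  have hτ0 : ∀ r, 0 < r → 0 ≤ τ r := fun r hr =>
    hτ.map_zero ▸ hτ.monotoneOn Set.self_mem_Ici hr.le hr.le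
  obtain ⟨r₁, hr₁⟩ := eventually_atTop.1 ((hτ.tendsto_atTop.eventually_ge_atTop 1).and
    ((eventually_ge_atTop 1).and ((eventually_ge_atTop t₀).and (eventually_ge_atTop t₁))))
  -- At t = r τ(r) the two terms t/r and c τ(r) balance.
  have up : ∀ r ≥ r₁, ω (r * τ r) ≤ (1 + c) * τ r := fun r hr => by
    obtain ⟨h1, h2, -⟩ := hr₁ r hr
    have hr0 : 0 < r := by linarith
    have := hU (r * τ r) (by nlinarith) r hr0
    rw [mul_div_cancel_left₀ _ hr0.ne'] at this
    linarith
  -- The near-optimal q is unknown, but monotonicity makes one term large: c τ(q) if q ≥ r, and t/q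
  -- if q ≤ r.
  have low : ∀ r ≥ r₁, τ r ≤ B * (1 + 1 / c) * ω (r * τ r) := fun r hr => by
    obtain ⟨h1, h2, h3, h4⟩ := hr₁ r hr
    have hr0 : 0 < r := by linarith
    obtain ⟨q, hq, hqL⟩ := hL (r * τ r) (by nlinarith)
    have hp : 0 ≤ c * τ q := mul_nonneg hc.le (hτ0 q hq)
    have hp' : 0 ≤ r * τ r / q := by positivity
    have hω0 : 0 ≤ B * ω (r * τ r) := by linarith
    rw [mul_right_comm, mul_add, mul_one]
    rcases le_total r q with hrq | hrq
    · have h5 : c * τ r ≤ c * τ q := by gcongr; exact hτ.monotoneOn hr0.le hq.le hrq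
      have h6 : τ r ≤ B * ω (r * τ r) * (1 / c) := by
        rw [mul_one_div, le_div_iff₀ hc]; linarith
      linarith
    · have h5 : τ r ≤ r * τ r / q := by
        rw [le_div_iff₀ hq]; nlinarith
      have : 0 ≤ B * ω (r * τ r) * (1 / c) := by positivity
      linarith
  set A := max (B * (1 + 1 / c) * (max C 0 * (1 + c))) 1
  have hA : 0 < A := lt_max_of_lt_right one_pos
  refine ⟨A ^ ((γ + 1) / γ), r₁, fun r hr lam hl => ?_⟩
  obtain ⟨h1, h2, h3, h4⟩ := hr₁ r hr
  have hr0 : 0 < r := by linarith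
  have hl0 : 0 < lam := by linarith
  have hlγ : 1 ≤ lam ^ γ := Real.one_le_rpow hl hγ.le
  have hR : r ≤ lam ^ γ * r := le_mul_of_one_le_left hr0.le hlγ
  have hτR : τ r ≤ τ (lam ^ γ * r) := hτ.monotoneOn hr0.le (hr0.le.trans hR) hR
  have hτr : 0 < τ r := by linarith
  set s := τ (lam ^ γ * r) / τ r with hs
  have hs1 : 1 ≤ s := (one_le_div hτr).2 hτR
  have hs0 : 0 < s := by linarith
  have hsτ : τ (lam ^ γ * r) = s * τ r := by rw [hs]; field_simp
  -- Chosen so that scaling by μ^(γ+1) carries r τ(r) to R τ(R) with R = lam^γ r.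
  set μ := (lam ^ γ * s) ^ (1 / (γ + 1)) with hμ
  have hμ1 : 1 ≤ μ := Real.one_le_rpow (by nlinarith) (by positivity)
  have hμpow : μ ^ (γ + 1) = lam ^ γ * s := by
    rw [hμ, ← Real.rpow_mul (by positivity), one_div_mul_cancel (by positivity), Real.rpow_one]
  have h5 : ω (lam ^ γ * r * τ (lam ^ γ * r)) ≤ max C 0 * (μ * ((1 + c) * τ r)) := by
    have e : lam ^ γ * r * τ (lam ^ γ * r) = μ ^ (γ + 1) * (r * τ r) := by
      rw [hμpow, hsτ]; ring
    have hpos : 0 ≤ ω (r * τ r) := by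
      have := low r hr
      have hh : 0 < B * (1 + 1 / c) := by positivity
      by_contra hneg
      nlinarith
    rw [e]
    refine (hC _ (by nlinarith) μ hμ1).trans ?_
    calc C * (μ * ω (r * τ r)) ≤ max C 0 * (μ * ω (r * τ r)) := by
          gcongr; exact le_max_left _ _
      _ ≤ _ := by gcongr; exact up r hr
  have h6 := low (lam ^ γ * r) (hr.le.trans hR)
  have h7 : s ≤ A * μ := by
    have h8 : s * τ r ≤ (A * μ) * τ r := by
      rw [← hsτ]
      calc τ (lam ^ γ * r) ≤ B * (1 + 1 / c) * (max C 0 * (μ * ((1 + c) * τ r))) :=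
            h6.trans (by gcongr)
        _ = B * (1 + 1 / c) * (max C 0 * (1 + c)) * (μ * τ r) := by ring
        _ ≤ A * (μ * τ r) := by gcongr; exact le_max_left _ _
        _ = _ := by ring
    exact le_of_mul_le_mul_right h8 hτr
  have h9 : s ≤ A ^ ((γ + 1) / γ) * lam := by
    -- Since μ itself contains s, the estimate s ≤ A μ is implicit; raised to the power γ + 1, it
    -- lets one factor s cancel.
    have h10 : s ^ (γ + 1) ≤ A ^ (γ + 1) * (lam ^ γ * s) := by
      rw [← hμpow, ← Real.mul_rpow hA.le (by positivity)]
      exact Real.rpow_le_rpow hs0.le h7 (by positivity)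
    have h11 : s ^ γ ≤ A ^ (γ + 1) * lam ^ γ := by
      rw [Real.rpow_add_one hs0.ne', ← mul_assoc] at h10
      exact le_of_mul_le_mul_right h10 hs0
    rw [← Real.rpow_le_rpow_iff hs0.le (by positivity) hγ,
      Real.mul_rpow (by positivity) hl0.le, ← Real.rpow_mul hA.le, div_mul_cancel₀ _ hγ.ne']
    exact h11
  calc τ (lam ^ γ * r) = s * τ r := hsτ
    _ ≤ A ^ ((γ + 1) / γ) * lam * τ r := by gcongr
    _ = _ := by ring

theorem gammaIndex_eq_add_one (hω : IsWeightFunction ω) (hτ : IsWeightFunction τ) (hc : 0 < c)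
    (hB : 0 < B)
    (hU : ∀ t > 0, ∀ r > 0, ω t ≤ t / r + c * τ r)
    (hL : ∀ t ≥ t₁, ∃ r > 0, t / r + c * τ r ≤ B * ω t) (hγ : 0 < gammaIndex τ) :
    gammaIndex ω = gammaIndex τ + 1 := by
  have hτeq := gammaIndex_eq_iSup_powerBound hτ
  have hle : ∀ γ : ℝ, 0 < γ → PowerBound τ γ → ENNReal.ofReal γ ≤ gammaIndex τ :=
    fun γ h0 h => hτeq ▸ le_iSup_of_le γ (le_iSup_of_le h0 (le_iSup_of_le h le_rfl))
  rw [gammaIndex_eq_iSup_powerBound hω]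
  refine le_antisymm (iSup_le fun γ => iSup_le fun _ => iSup_le fun h => ?_) ?_
  · rcases le_or_gt γ 1 with h1 | h1
    · exact (ENNReal.ofReal_le_one.2 h1).trans le_add_self
    · have h2 : 0 < γ - 1 := by linarith
      have h3 := hle (γ - 1) h2
        (PowerBound.of_add_one hτ hc hB hU hL h2 (by rwa [sub_add_cancel]))
      calc ENNReal.ofReal γ = ENNReal.ofReal (γ - 1) + 1 := by
            rw [← ENNReal.ofReal_one, ← ENNReal.ofReal_add h2.le zero_le_one, sub_add_cancel]
        _ ≤ _ := by gcongr
  · refine le_of_forall_lt fun a ha => ?_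
    -- For a < 1 any admissible exponent will do; its existence is what positivity of the index of τ
    -- provides.
    have hex : ∃ γ : ℝ, 0 < γ ∧ PowerBound τ γ ∧ a < ENNReal.ofReal γ + 1 := by
      rcases le_or_gt 1 a with h1 | h1
      · have h2 : a - 1 < gammaIndex τ := ENNReal.sub_lt_of_lt_add h1 ha
        rw [hτeq] at h2
        simp only [lt_iSup_iff] at h2
        obtain ⟨γ, h0, hp, hlt⟩ := h2
        exact ⟨γ, h0, hp, tsub_add_cancel_of_le h1 ▸ ENNReal.add_lt_add_right ENNReal.one_ne_top hlt⟩
      · rw [hτeq] at hγ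
        simp only [lt_iSup_iff] at hγ
        obtain ⟨γ, h0, hp, -⟩ := hγ
        exact ⟨γ, h0, hp, h1.trans_le le_add_self⟩
    obtain ⟨γ, h0, hp, hlt⟩ := hex
    refine hlt.trans_le ?_
    rw [← ENNReal.ofReal_one, ← ENNReal.ofReal_add h0.le zero_le_one]
    exact le_iSup_of_le (γ + 1) (le_iSup_of_le (by linarith)
      (le_iSup_of_le (hp.add_one hτ hc hB hU hL) le_rfl))

end Transfer

/-! ### The associated function of `T̂` -/

theorem IsWeightFunction.nonneg {ω : ℝ → ℝ} (hω : IsWeightFunction ω) {t : ℝ} (ht : 0 ≤ t) :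
    0 ≤ ω t :=
  hω.map_zero ▸ hω.monotoneOn Set.self_mem_Ici ht ht

theorem le_youngConj {ω : ℝ → ℝ} (hω : IsNormalizedWeight ω) (h3 : Omega3 ω) {s : ℝ}
    (hs : 0 ≤ s) (y : ℝ) : s * y - ω (Real.exp y) ≤ youngConj ω s :=
  le_ciSup (bddAbove_youngConj hω h3 hs) y

theorem youngConj_le {ω : ℝ → ℝ} {s b : ℝ} (h : ∀ y, s * y - ω (Real.exp y) ≤ b) :
    youngConj ω s ≤ b :=
  ciSup_le h

theorem youngConj_zero {ω : ℝ → ℝ} (hω : IsNormalizedWeight ω) (h3 : Omega3 ω) :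
    youngConj ω 0 = 0 := by
  refine le_antisymm (youngConj_le fun y => ?_) ?_
  · simpa using hω.nonneg (Real.exp_pos y).le
  · simpa [hω.eq_zero 1 (by simp)] using le_youngConj hω h3 le_rfl 0

/-- Logarithmic form of u^p/p! ≤ e^u. -/
theorem natCast_mul_log_le (p : ℕ) {u : ℝ} (hu : 0 < u) : p * Real.log u ≤ u + Real.log (p !) := by
  have hp : (0 : ℝ) < p ! := by positivity
  have h := Real.log_le_log (by positivity) (Real.pow_div_factorial_le_exp u hu.le p)
  rw [Real.log_exp, Real.log_div (by positivity) hp.ne', Real.log_pow] at h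
  linarith

theorem log_factorial_le (p : ℕ) : Real.log (p !) ≤ p * Real.log p := by
  rw [← Real.log_pow]
  exact Real.log_le_log (by positivity) (by exact_mod_cast Nat.factorial_le_pow p)

/-- A weak form of Stirling's formula. -/
theorem log_factorial_le_sub {p : ℕ} (hp : 1 ≤ p) :
    Real.log (p !) ≤ p * Real.log p - p / 2 + 1 := by
  induction p, hp using Nat.le_induction with
  | base => norm_num
  | succ p hp ih =>
    have hp0 : (0 : ℝ) < p := by exact_mod_cast hp
    have hp1 : (1 : ℝ) ≤ p := by exact_mod_cast hp
    rw [Nat.factorial_succ, Nat.cast_mul, Real.log_mul (by positivity) (by positivity)]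
    push_cast
    have h1 : 1 / 2 ≤ p * (Real.log (p + 1) - Real.log p) := by
      rw [← Real.log_div (by positivity) hp0.ne']
      have h2 := Real.one_sub_inv_le_log_of_pos (x := (p + 1) / p) (by positivity)
      have h3 : 1 / 2 ≤ p * (1 - ((p + 1 : ℝ) / p)⁻¹) := by
        rw [inv_div, one_sub_div (by positivity), ← mul_div_assoc, div_le_div_iff₀ two_pos
          (by positivity)]
        linarith
      exact h3.trans (by gcongr)
    nlinarith

section HatMatrix

variable {τ : ℝ → ℝ} (x : PosReal)

theorem coe_hatMatrix (p : ℕ) :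
    (hatMatrix τ x p : ℝ) = p ! * Real.exp (1 / (x : ℝ) * youngConj τ (x * p)) :=
  rfl

theorem log_pow_div_hatMatrix {t : ℝ} (ht : 0 < t) (p : ℕ) :
    Real.log (t ^ p / hatMatrix τ x p)
      = p * Real.log t - Real.log (p !) - 1 / (x : ℝ) * youngConj τ (x * p) := by
  rw [coe_hatMatrix, Real.log_div (by positivity) (by positivity),
    Real.log_mul (by positivity) (by positivity), Real.log_exp, Real.log_pow]
  ring

/-- Split t^p = (t/r)^p r^p: the factorial controls the first factor, and Young's inequality at log
r the second. -/
theorem log_pow_div_hatMatrix_le (hτ : IsNormalizedWeight τ) (h3 : Omega3 τ) {t r : ℝ}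
    (ht : 0 < t) (hr : 0 < r) (p : ℕ) :
    Real.log (t ^ p / hatMatrix τ x p) ≤ t / r + 1 / (x : ℝ) * τ r := by
  have hx := x.2
  rw [log_pow_div_hatMatrix x ht]
  have h1 := le_youngConj hτ h3 (s := x * p) (by positivity) (Real.log r)
  rw [Real.exp_log hr] at h1
  have h2 := natCast_mul_log_le p (div_pos ht hr)
  rw [Real.log_div ht.ne' hr.ne'] at h2
  have h3 : p * Real.log r - 1 / (x : ℝ) * τ r ≤ 1 / (x : ℝ) * youngConj τ (x * p) := by
    have := mul_le_mul_of_nonneg_left h1 (one_div_pos.2 hx).le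
    refine le_trans (le_of_eq ?_) this
    field_simp
  linarith

theorem bddAbove_log_pow_div_hatMatrix (hτ : IsNormalizedWeight τ) (h3 : Omega3 τ) {t : ℝ}
    (ht : 0 < t) : BddAbove (Set.range fun p : ℕ => Real.log (t ^ p / hatMatrix τ x p)) := by
  refine ⟨t / 1 + 1 / (x : ℝ) * τ 1, ?_⟩
  rintro _ ⟨p, rfl⟩
  exact log_pow_div_hatMatrix_le x hτ h3 ht one_pos p

theorem assocFun_of_pos (M : WeightSeq) {t : ℝ} (ht : 0 < t) :
    assocFun M t = ⨆ p : ℕ, Real.log (t ^ p / M p) :=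
  if_neg ht.ne'

theorem assocFun_hatMatrix_le (hτ : IsNormalizedWeight τ) (h3 : Omega3 τ) {t r : ℝ}
    (ht : 0 < t) (hr : 0 < r) :
    assocFun (hatMatrix τ x) t ≤ t / r + 1 / (x : ℝ) * τ r := by
  rw [assocFun_of_pos _ ht]
  exact ciSup_le fun p => log_pow_div_hatMatrix_le x hτ h3 ht hr p

theorem le_assocFun_hatMatrix (hτ : IsNormalizedWeight τ) (h3 : Omega3 τ) {t : ℝ}
    (ht : 0 < t) (p : ℕ) :
    p * Real.log t - Real.log (p !) - 1 / (x : ℝ) * youngConj τ (x * p)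
      ≤ assocFun (hatMatrix τ x) t := by
  rw [assocFun_of_pos _ ht, ← log_pow_div_hatMatrix x ht]
  exact le_ciSup (bddAbove_log_pow_div_hatMatrix x hτ h3 ht) p

theorem assocFun_hatMatrix_nonneg (hτ : IsNormalizedWeight τ) (h3 : Omega3 τ) {t : ℝ}
    (ht : 0 ≤ t) : 0 ≤ assocFun (hatMatrix τ x) t := by
  rcases ht.eq_or_lt with rfl | ht
  · simp [assocFun]
  · simpa [youngConj_zero hτ h3] using le_assocFun_hatMatrix x hτ h3 ht 0

/-- In the variable log t, the associated function is a supremum of affine functions. -/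
theorem omega4_assocFun_hatMatrix (hτ : IsNormalizedWeight τ) (h3 : Omega3 τ) :
    Omega4 (assocFun (hatMatrix τ x)) := by
  refine ⟨convex_univ, fun y _ z _ a b ha hb hab => ?_⟩
  beta_reduce
  rw [assocFun_of_pos _ (Real.exp_pos (a • y + b • z))]
  refine ciSup_le fun p => ?_
  rw [log_pow_div_hatMatrix x (Real.exp_pos _), Real.log_exp]
  have h1 := mul_le_mul_of_nonneg_left (le_assocFun_hatMatrix x hτ h3 (Real.exp_pos y) p) ha
  have h2 := mul_le_mul_of_nonneg_left (le_assocFun_hatMatrix x hτ h3 (Real.exp_pos z) p) hb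
  rw [Real.log_exp] at h1 h2
  simp only [smul_eq_mul]
  obtain rfl : b = 1 - a := by linarith
  linarith

/-- A single term of the supremum, with p > 1/c, already dominates (1/c) log t for large t. -/
theorem omega3_assocFun_hatMatrix (hτ : IsNormalizedWeight τ) (h3 : Omega3 τ) :
    Omega3 (assocFun (hatMatrix τ x)) := by
  refine isLittleO_iff.2 fun c hc => ?_
  obtain ⟨p, hp⟩ := exists_nat_gt (1 / c)
  set A := Real.log (p !) + 1 / (x : ℝ) * youngConj τ (x * p)
  have hp' : 0 < c * p - 1 := by
    rw [div_lt_iff₀ hc] at hp; linarith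
  filter_upwards [eventually_ge_atTop 1,
    Real.tendsto_log_atTop.eventually_ge_atTop (c * A / (c * p - 1))] with t ht hlog
  have ht0 : 0 < t := by linarith
  rw [Real.norm_of_nonneg (Real.log_nonneg ht),
    Real.norm_of_nonneg (assocFun_hatMatrix_nonneg x hτ h3 ht0.le)]
  have h1 := mul_le_mul_of_nonneg_left (le_assocFun_hatMatrix x hτ h3 ht0 p) hc.le
  rw [div_le_iff₀ hp'] at hlog
  simp only [A] at hlog
  linarith

theorem isNormalizedWeight_assocFun_hatMatrix (hτ : IsNormalizedWeight τ) (h3 : Omega3 τ) :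
    IsNormalizedWeight (assocFun (hatMatrix τ x)) := by
  have hx := x.2
  have hzero : ∀ t ∈ Set.Icc (0 : ℝ) 1, assocFun (hatMatrix τ x) t = 0 := by
    rintro t ⟨ht0, ht1⟩
    refine le_antisymm ?_ (assocFun_hatMatrix_nonneg x hτ h3 ht0)
    rcases ht0.eq_or_lt with rfl | ht
    · simp [assocFun]
    rw [assocFun_of_pos _ ht]
    refine ciSup_le fun p => ?_
    rw [log_pow_div_hatMatrix x ht]
    have h1 : p * Real.log t ≤ 0 :=
      mul_nonpos_of_nonneg_of_nonpos (by positivity) (Real.log_nonpos ht0 ht1)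
    have h2 : 0 ≤ Real.log (p !) := Real.log_natCast_nonneg _
    have h4 : 0 ≤ youngConj τ (x * p) := by
      simpa [hτ.eq_zero 1 (by simp)] using le_youngConj hτ h3 (s := x * p) (by positivity) 0
    have h5 : 0 ≤ 1 / (x : ℝ) * youngConj τ (x * p) := by positivity
    linarith
  refine ⟨⟨?_, ?_, ?_, ?_⟩, hzero⟩
  · intro t ht
    rcases (Set.mem_Ici.1 ht).eq_or_lt with rfl | ht
    · refine (continuousWithinAt_const (b := (0 : ℝ))).congr_of_eventuallyEq ?_
        (hzero 0 (by simp))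
      filter_upwards [self_mem_nhdsWithin, mem_nhdsWithin_of_mem_nhds (Iio_mem_nhds one_pos)]
        with s hs0 hs1
      exact hzero s ⟨hs0, le_of_lt hs1⟩
    · refine ContinuousAt.continuousWithinAt ?_
      -- Away from 0, continuity is that of a finite convex function on ℝ.
      have hc : Continuous fun y : ℝ => assocFun (hatMatrix τ x) (Real.exp y) :=
        continuousOn_univ.1 ((omega4_assocFun_hatMatrix x hτ h3).continuousOn isOpen_univ)
      have h : ContinuousAt (fun s : ℝ => assocFun (hatMatrix τ x) (Real.exp (Real.log s))) t :=
        hc.continuousAt.comp (Real.continuousAt_log ht.ne')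
      refine h.congr ?_
      filter_upwards [Ioi_mem_nhds ht] with s hs
      rw [Real.exp_log hs]
  · intro s hs t ht hst
    rcases (Set.mem_Ici.1 hs).eq_or_lt with rfl | hs
    · rw [hzero 0 (by simp)]
      exact assocFun_hatMatrix_nonneg x hτ h3 ht
    · rw [assocFun_of_pos _ hs]
      refine ciSup_le fun p => ?_
      have ht0 := hs.trans_le hst
      refine le_trans ?_ (le_assocFun_hatMatrix x hτ h3 ht0 p)
      rw [log_pow_div_hatMatrix x hs]
      gcongr
  · simp [assocFun]
  · refine tendsto_atTop_mono' atTop ?_ (tendsto_atTop_add_const_right _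
      (-(1 / (x : ℝ) * youngConj τ (x * (1 : ℕ)))) Real.tendsto_log_atTop)
    filter_upwards [eventually_gt_atTop 0] with t ht
    simpa [sub_eq_add_neg] using le_assocFun_hatMatrix x hτ h3 ht 1

/-- The minimizer `y` of `c φ(z) + t exp (-z)`, where `φ z = τ (exp z)`, together with the
supporting line of `c φ` at `y`, whose slope is `t exp (-y)`. -/
theorem exists_supporting_line (hτ : IsNormalizedWeight τ) (h4 : Omega4 τ) {c t : ℝ}
    (hc : 0 < c) (ht : 0 < t) : ∃ y : ℝ, ∀ z : ℝ,
      c * τ (Real.exp y) + t * Real.exp (-y) * (z - y) ≤ c * τ (Real.exp z) := by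
  have hcont : Continuous fun z : ℝ => c * τ (Real.exp z) + t * Real.exp (-z) :=
    (continuous_const.mul (hτ.continuousOn.comp_continuous Real.continuous_exp
      fun z => (Real.exp_pos z).le)).add (by fun_prop)
  have hnn : ∀ z : ℝ, 0 ≤ c * τ (Real.exp z) := fun z =>
    mul_nonneg hc.le (hτ.nonneg (Real.exp_pos z).le)
  have hlim : Tendsto (fun z : ℝ => c * τ (Real.exp z) + t * Real.exp (-z)) (cocompact ℝ)
      atTop := by
    rw [cocompact_eq_atBot_atTop]
    refine Tendsto.sup ?_ ?_
    · refine tendsto_atTop_mono (fun z => le_add_of_nonneg_left (hnn z)) ?_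
      exact (Real.tendsto_exp_atTop.comp tendsto_neg_atBot_atTop).const_mul_atTop ht
    · refine tendsto_atTop_mono (fun z => le_add_of_nonneg_right (by positivity)) ?_
      exact (hτ.tendsto_atTop.comp Real.tendsto_exp_atTop).const_mul_atTop hc
  obtain ⟨y, hy⟩ := hcont.exists_forall_le hlim
  refine ⟨y, fun z => ?_⟩
  set s := t * Real.exp (-y) with hs
  have hs0 : 0 < s := by positivity
  set d := z - y with hd
  -- Compare minimality at y + εd with convexity on the segment from y to z. Since |e^u - 1 - u| ≤
  -- u² for |u| ≤ 1, division by ε leaves an error of order ε, which then tends to 0.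
  have key : ∀ ε : ℝ, 0 < ε → ε * |d| ≤ 1 → ε ≤ 1 →
      s * d - ε * (s * d ^ 2) ≤ c * τ (Real.exp z) - c * τ (Real.exp y) := by
    intro ε hε hεd hε1
    have h1 := h4.2 (Set.mem_univ y) (Set.mem_univ z) (sub_nonneg.2 hε1) hε.le
      (sub_add_cancel 1 ε)
    simp only [smul_eq_mul] at h1
    have e : (1 - ε) * y + ε * z = y + ε * d := by rw [hd]; ring
    rw [e] at h1
    have h2 := hy (y + ε * d)
    have e2 : t * Real.exp (-(y + ε * d)) = s * Real.exp (-(ε * d)) := by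
      rw [hs, neg_add, Real.exp_add]; ring
    rw [e2] at h2
    have h3 := (abs_le.1 (Real.abs_exp_sub_one_sub_id_le (x := -(ε * d))
      (by rwa [abs_neg, abs_mul, abs_of_pos hε]))).2
    have h5 := mul_le_mul_of_nonneg_left h3 hs0.le
    have h6 := mul_le_mul_of_nonneg_left h1 hc.le
    refine le_of_mul_le_mul_left ?_ hε
    nlinarith
  have hl : Tendsto (fun ε : ℝ => s * d - ε * (s * d ^ 2)) (𝓝[>] 0) (𝓝 (s * d)) := by
    have : ContinuousAt (fun ε : ℝ => s * d - ε * (s * d ^ 2)) 0 := by fun_prop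
    simpa using this.tendsto.mono_left nhdsWithin_le_nhds
  have hfin := le_of_tendsto (b := c * τ (Real.exp z) - c * τ (Real.exp y)) hl (by
    have h1 : ∀ᶠ ε : ℝ in 𝓝[>] 0, ε < 1 / (|d| + 1) :=
      nhdsWithin_le_nhds (Iio_mem_nhds (by positivity))
    filter_upwards [self_mem_nhdsWithin, h1] with ε hε h1
    rw [lt_div_iff₀ (by positivity)] at h1
    have hε0 : 0 < ε := hε
    have hd0 := abs_nonneg d
    exact key ε hε (by nlinarith) (by nlinarith))
  linarith

/-- Take r = e^y at the minimizer, s = t/r and F = τ(r)/x. The term p = ⌊s⌋ of the supremum is at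
least p/2 + F/2 - 1, and s < 2p. -/
theorem exists_le_assocFun_hatMatrix_of_large (hτ : IsNormalizedWeight τ) (h3 : Omega3 τ)
    (h4 : Omega4 τ) : ∃ t₀ > 0, ∀ t ≥ t₀, ∃ r > 0,
      t / r + 1 / (x : ℝ) * τ r ≤ 4 * assocFun (hatMatrix τ x) t + 4 := by
  have hx := x.2
  have hx' : 0 < 1 / (x : ℝ) := one_div_pos.2 hx
  obtain ⟨t₀, ht₀⟩ := eventually_atTop.1 (h3.def (c := 1 / (2 * x)) (by positivity))
  refine ⟨max t₀ 2, lt_max_of_lt_right two_pos, fun t ht => ?_⟩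
  have ht2 : 2 ≤ t := (le_max_right _ _).trans ht
  have ht0 : 0 < t := by linarith
  obtain ⟨y, hy⟩ := exists_supporting_line hτ h4 hx' ht0
  set s := t * Real.exp (-y) with hs
  have hs0 : 0 < s := by positivity
  have hts : t / Real.exp y = s := by rw [hs, Real.exp_neg]; rfl
  have hlogs : Real.log s = Real.log t - y := by
    rw [hs, Real.log_mul ht0.ne' (Real.exp_pos _).ne', Real.log_exp]; ring
  -- If s < 1, then y > log t > 0, and the supporting line at z = 0, where τ vanishes, gives F ≤ s y
  -- < y. But t₀ was chosen so that (ω₃) yields F ≥ 2y.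
  have hs1 : 1 ≤ s := by
    by_contra! hs1
    have hlog : Real.log t < y := by
      have := Real.log_neg hs0 hs1
      linarith
    have ht' : t ≤ Real.exp y := by
      rw [← Real.exp_log ht0]; exact Real.exp_le_exp.2 hlog.le
    have hy0 : 0 < y := (Real.log_pos (by linarith)).trans hlog
    have h1 := ht₀ (Real.exp y) (((le_max_left _ _).trans ht).trans ht')
    rw [Real.log_exp, Real.norm_of_nonneg hy0.le,
      Real.norm_of_nonneg (hτ.nonneg (Real.exp_pos y).le), div_mul_eq_mul_div, one_mul,
      le_div_iff₀ (by positivity)] at h1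
    have h2 := hy 0
    rw [Real.exp_zero, hτ.eq_zero 1 (by simp), mul_zero] at h2
    have h5 : 1 / (x : ℝ) * τ (Real.exp y) ≥ 2 * y := by
      rw [ge_iff_le, one_div, ← div_eq_inv_mul, le_div_iff₀ hx]; linarith
    nlinarith
  refine ⟨Real.exp y, Real.exp_pos y, ?_⟩
  rw [hts]
  set p := ⌊s⌋₊
  have hp1 : 1 ≤ p := Nat.one_le_floor_iff _ |>.2 hs1
  have hp1' : (1 : ℝ) ≤ p := by exact_mod_cast hp1
  have hps : (p : ℝ) ≤ s := Nat.floor_le hs0.le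
  have hsp : s < p + 1 := Nat.lt_floor_add_one s
  set F := 1 / (x : ℝ) * τ (Real.exp y) with hF
  have hF0 : 0 ≤ F := mul_nonneg hx'.le (hτ.nonneg (Real.exp_pos y).le)
  -- Multiplying the supporting line by p/s ≤ 1 makes its slope the integer p and keeps it below
  -- φ/x, because φ ≥ 0.
  have hconj : 1 / (x : ℝ) * youngConj τ (x * p) ≤ p * y - p / s * F := by
    rw [one_div, inv_mul_le_iff₀ hx]
    refine youngConj_le fun z => ?_
    have h1 : p / s * (1 / (x : ℝ) * τ (Real.exp z)) ≤ 1 / (x : ℝ) * τ (Real.exp z) :=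
      mul_le_of_le_one_left (mul_nonneg hx'.le (hτ.nonneg (Real.exp_pos z).le))
        ((div_le_one hs0).2 hps)
    have h2 := mul_le_mul_of_nonneg_left (hy z) (by positivity : 0 ≤ p / s)
    have h5 : p / s * (F + s * (z - y)) = p / s * F + p * (z - y) := by
      field_simp
    have h6 : (x : ℝ) * (1 / (x : ℝ) * τ (Real.exp z)) = τ (Real.exp z) := by field_simp
    rw [h5] at h2
    have h7 := mul_le_mul_of_nonneg_left (h2.trans h1) hx.le
    rw [h6] at h7
    linarith
  have h1 := le_assocFun_hatMatrix x hτ h3 ht0 p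
  have h2 := log_factorial_le_sub hp1
  have h5 : p * Real.log p ≤ p * (Real.log t - y) := by
    rw [← hlogs]; gcongr
  have h6 : 1 / 2 * F ≤ p / s * F := by
    refine mul_le_mul_of_nonneg_right ?_ hF0
    rw [div_le_div_iff₀ two_pos hs0]
    linarith
  linarith

theorem exists_le_assocFun_hatMatrix (hτ : IsNormalizedWeight τ) (h3 : Omega3 τ)
    (h4 : Omega4 τ) : ∃ C : ℝ, ∀ t > 0, ∃ r > 0,
      t / r + 1 / (x : ℝ) * τ r ≤ 4 * assocFun (hatMatrix τ x) t + C := by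
  obtain ⟨t₀, ht₀, h⟩ := exists_le_assocFun_hatMatrix_of_large x hτ h3 h4
  refine ⟨4 * assocFun (hatMatrix τ x) t₀ + 4, fun t ht => ?_⟩
  have h0 := assocFun_hatMatrix_nonneg x hτ h3 ht.le
  have h0' := assocFun_hatMatrix_nonneg x hτ h3 ht₀.le
  rcases le_total t₀ t with h1 | h1
  · obtain ⟨r, hr, hle⟩ := h t h1
    exact ⟨r, hr, by linarith⟩
  -- The r belonging to t₀ still works, as t/r only decreases.
  · obtain ⟨r, hr, hle⟩ := h t₀ le_rfl
    have : t / r ≤ t₀ / r := by gcongr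
    exact ⟨r, hr, by linarith⟩

theorem gammaIndex_assocFun_hatMatrix (hτ : IsNormalizedWeight τ) (h3 : Omega3 τ)
    (h4 : Omega4 τ) (hγ : 0 < gammaIndex τ) :
    gammaIndex (assocFun (hatMatrix τ x)) = gammaIndex τ + 1 := by
  have hω := isNormalizedWeight_assocFun_hatMatrix x hτ h3
  obtain ⟨t₀, ht₀, h⟩ := exists_le_assocFun_hatMatrix_of_large x hτ h3 h4
  obtain ⟨t₁, ht₁⟩ := eventually_atTop.1 (hω.tendsto_atTop.eventually_ge_atTop 1)
  -- B = 8 because 4ω + 4 ≤ 8ω as soon as ω ≥ 1.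
  refine gammaIndex_eq_add_one (c := 1 / (x : ℝ)) (B := 8) (t₁ := max t₀ t₁)
    hω.toIsWeightFunction hτ.toIsWeightFunction
    (one_div_pos.2 x.2) (by norm_num)
    (fun t ht r hr => assocFun_hatMatrix_le x hτ h3 ht hr) (fun t ht => ?_) hγ
  obtain ⟨r, hr, hle⟩ := h t ((le_max_left _ _).trans ht)
  have := ht₁ t ((le_max_right _ _).trans ht)
  exact ⟨r, hr, by linarith⟩

/-! ### Comparison of the weight matrix of `ω_{T̂^x}` with `T̂` -/

theorem pow_mul_hatMatrix_le (hτ : IsNormalizedWeight τ) (h3 : Omega3 τ) (l : PosReal) (p : ℕ) :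
    ((l : ℝ) / Real.exp 1) ^ p * hatMatrix τ (x * l) p
      ≤ weightMatrix (assocFun (hatMatrix τ x)) l p := by
  have hx := x.2
  have hl := l.2
  have hω := isNormalizedWeight_assocFun_hatMatrix x hτ h3
  have hω3 := omega3_assocFun_hatMatrix x hτ h3
  have hpos := (hatMatrix τ (x * l) p).2
  rw [← Real.log_le_log_iff (by positivity) (weightMatrix _ l p).2, coe_hatMatrix,
    Real.log_mul (by positivity) (by positivity), Real.log_mul (by positivity) (by positivity),
    Real.log_exp, Real.log_pow, Real.log_div hl.ne' (Real.exp_pos 1).ne', Real.log_exp]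
  change _ ≤ Real.log (Real.exp (1 / (l : ℝ) * youngConj _ (l * p)))
  rw [Real.log_exp]
  change _ + (_ + 1 / ((x : ℝ) * l) * youngConj τ ((x : ℝ) * l * p)) ≤ _
  rcases Nat.eq_zero_or_pos p with rfl | hp
  · simp [youngConj_zero hτ h3, youngConj_zero hω hω3]
  have hp0 : (0 : ℝ) < p := by exact_mod_cast hp
  suffices h : youngConj τ ((x : ℝ) * l * p) ≤ (x * l) *
      (1 / (l : ℝ) * youngConj (assocFun (hatMatrix τ x)) (l * p)
        - p * (Real.log l - 1) - Real.log (p !)) by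
    rw [← div_le_iff₀' (by positivity)] at h
    rw [one_div_mul_eq_div]
    linarith
  refine youngConj_le fun y => ?_
  -- This t maximizes l p log t - t/r for r = e^y. The maximum yields the factor (l/e)^p, and p^p,
  -- which dominates p!. For p = 0 it would degenerate to t = 0.
  set t := (l : ℝ) * p * Real.exp y with ht
  have ht0 : 0 < t := by positivity
  have h1 := le_youngConj hω hω3 (s := l * p) (by positivity) (Real.log t)
  have h2 := assocFun_hatMatrix_le x hτ h3 ht0 (Real.exp_pos y)
  have hlog : Real.log t = Real.log l + Real.log p + y := by
    rw [ht, Real.log_mul (by positivity) (by positivity), Real.log_mul hl.ne' hp0.ne',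
      Real.log_exp]
  rw [Real.exp_log ht0, hlog] at h1
  have h5 : t / Real.exp y = l * p := by rw [ht]; field_simp
  rw [h5] at h2
  have h6 := log_factorial_le p
  have h7 : (x : ℝ) * (l * p * (Real.log l + Real.log p + y) - l * p) - τ (Real.exp y)
      ≤ x * youngConj (assocFun (hatMatrix τ x)) (l * p) := by
    have := mul_le_mul_of_nonneg_left (h1.trans' (sub_le_sub_left h2 _)) hx.le
    refine le_trans (le_of_eq ?_) this
    field_simp
    ring
  have h8 := mul_le_mul_of_nonneg_left h6 (mul_pos hx hl).le
  have h9 : (x : ℝ) * l * (1 / (l : ℝ) * youngConj (assocFun (hatMatrix τ x)) (l * p)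
        - p * (Real.log l - 1) - Real.log (p !))
      = x * youngConj (assocFun (hatMatrix τ x)) (l * p)
        - x * l * p * (Real.log l - 1) - x * l * Real.log (p !) := by
    field_simp
  rw [h9]
  linarith

theorem exists_weightMatrix_le (hτ : IsNormalizedWeight τ) (h3 : Omega3 τ) (h4 : Omega4 τ)
    (l : PosReal) : ∃ (m h : PosReal) (C : ℝ), ∀ p,
      (weightMatrix (assocFun (hatMatrix τ x)) l p : ℝ) ≤ C * ((h : ℝ) ^ p * hatMatrix τ m p) := by
  have hx := x.2
  have hl := l.2
  obtain ⟨C, hC⟩ := exists_le_assocFun_hatMatrix x hτ h3 h4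
  let m : PosReal := ⟨4 * x * l, by positivity⟩
  let h : PosReal := ⟨4 * l, by positivity⟩
  refine ⟨m, h, Real.exp (C / (4 * l)), fun p => ?_⟩
  have hm : (hatMatrix τ m p : ℝ)
      = p ! * Real.exp (1 / (4 * x * l : ℝ) * youngConj τ (4 * x * l * p)) := rfl
  rw [hm]
  change Real.exp (1 / (l : ℝ) * youngConj _ (l * p)) ≤ _ * ((4 * (l : ℝ)) ^ p * _)
  rw [← Real.log_le_log_iff (by positivity) (by positivity),
    Real.log_mul (by positivity) (by positivity), Real.log_mul (by positivity) (by positivity),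
    Real.log_mul (by positivity) (by positivity), Real.log_exp, Real.log_exp, Real.log_exp,
    Real.log_pow, one_div, inv_mul_le_iff₀ hl]
  refine youngConj_le fun z => ?_
  obtain ⟨r, hr, hle⟩ := hC (Real.exp z) (Real.exp_pos z)
  have h1 := le_youngConj hτ h3 (s := 4 * x * l * p) (by positivity) (Real.log r)
  rw [Real.exp_log hr] at h1
  -- The scaling makes l u equal to a quarter of t/r for t = e^z, cancelling the term in the lower
  -- bound for ω. The remaining τ(r)/(4x) dictates the parameter 4xl of `m`.
  set u := Real.exp z / (4 * l * r) with hu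
  have hu0 : 0 < u := by positivity
  have h2 := natCast_mul_log_le p hu0
  have hlog : Real.log u = z - Real.log (4 * l) - Real.log r := by
    rw [hu, Real.log_div (Real.exp_pos z).ne' (by positivity), Real.log_exp,
      Real.log_mul (by positivity) hr.ne']
    ring
  rw [hlog] at h2
  have h5 : Real.exp z / r = 4 * l * u := by rw [hu]; field_simp
  rw [h5] at hle
  have h6 : p * Real.log r - 1 / (4 * x * l) * τ r
      ≤ 1 / (4 * x * l) * youngConj τ (4 * x * l * p) := by
    have := mul_le_mul_of_nonneg_left h1 (by positivity : 0 ≤ 1 / (4 * x * l : ℝ))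
    refine le_trans (le_of_eq ?_) this
    field_simp
  have h7 := mul_le_mul_of_nonneg_left (add_le_add h2 h6) hl.le
  have h8 : (l : ℝ) * (1 / (4 * x * l) * τ r) = 1 / 4 * (1 / x * τ r) := by field_simp
  have h9 : (l : ℝ) * (C / (4 * l)) = C / 4 := by field_simp
  have h10 : (l : ℝ) * (C / (4 * l) + (p * Real.log (4 * l) + (Real.log (p !)
        + 1 / (4 * x * l) * youngConj τ (4 * x * l * p))))
      = C / 4 + (l * (p * Real.log (4 * l)) + (l * Real.log (p !)
        + l * (1 / (4 * x * l) * youngConj τ (4 * x * l * p)))) := by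
    rw [mul_add, h9, mul_add, mul_add]
  rw [h10]
  rw [mul_add, mul_sub (l : ℝ) (p * Real.log r), h8] at h7
  linarith

theorem matrixClass_hatMatrix_eq {V ι : Type*} [AddCommGroup V] [Module ℂ V]
    (D : ι → ℕ → V →ₗ[ℂ] ℂ) (hτ : IsNormalizedWeight τ) (h3 : Omega3 τ) (h4 : Omega4 τ) :
    matrixClass D (hatMatrix τ) = weightClass D (assocFun (hatMatrix τ x)) := by
  refine matrixClass_eq_weightClass D _ _ (fun y h => ?_) (exists_weightMatrix_le x hτ h3 h4)
  have hx := x.2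
  have hh := h.2
  -- Large enough that l/e ≥ h absorbs the geometric factor and x l ≥ y absorbs the matrix
  -- parameter.
  let l : PosReal := ⟨max (h * Real.exp 1) (y / x), lt_max_of_lt_left (by positivity)⟩
  refine ⟨l, 1, fun p => ?_⟩
  rw [one_mul]
  have hyl : y ≤ x * l := by
    change (y : ℝ) ≤ x * max (h * Real.exp 1) (y / x)
    rw [← div_le_iff₀' hx]
    exact le_max_right _ _
  have hhl : (h : ℝ) ≤ l / Real.exp 1 := by
    rw [le_div_iff₀ (Real.exp_pos 1)]
    exact le_max_left _ _
  have hmono : (hatMatrix τ y p : ℝ) ≤ hatMatrix τ (x * l) p :=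
    mul_le_mul_of_nonneg_left (weightMatrix_mono hτ h3 hyl p) (by positivity)
  refine le_trans ?_ (pow_mul_hatMatrix_le x hτ h3 l p)
  have := (hatMatrix τ y p).2
  gcongr

end HatMatrix

theorem theorem4p3 (τ : ℝ → ℝ) (hτ : IsNormalizedWeight τ) (h3 : Omega3 τ) (h4 : Omega4 τ)
    (hγ : 0 < gammaIndex τ) (x : PosReal) :
    (∀ a b : ℝ, a < b →
      ultraholMatrix a b (hatMatrix τ) = ultraholWeight a b (assocFun (hatMatrix τ x))) ∧
    lambdaMatrix (hatMatrix τ) = lambdaWeight (assocFun (hatMatrix τ x)) ∧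
    (∀ t : ℝ, 0 < t → BddAbove (Set.range fun p : ℕ => Real.log (t ^ p / hatMatrix τ x p))) ∧
    IsNormalizedWeight (assocFun (hatMatrix τ x)) ∧
    Omega3 (assocFun (hatMatrix τ x)) ∧
    Omega4 (assocFun (hatMatrix τ x)) ∧
    gammaIndex (assocFun (hatMatrix τ x)) = gammaIndex τ + 1 ∧
    1 < gammaIndex (assocFun (hatMatrix τ x)) := by
  have hindex := gammaIndex_assocFun_hatMatrix x hτ h3 h4 hγ
  refine ⟨fun a b _ => matrixClass_hatMatrix_eq x _ hτ h3 h4,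
    matrixClass_hatMatrix_eq x _ hτ h3 h4,
    fun t ht => bddAbove_log_pow_div_hatMatrix x hτ h3 ht,
    isNormalizedWeight_assocFun_hatMatrix x hτ h3, omega3_assocFun_hatMatrix x hτ h3,
    omega4_assocFun_hatMatrix x hτ h3, hindex, ?_⟩
  rw [hindex, add_comm]
  exact ENNReal.lt_add_right ENNReal.one_ne_top hγ.ne'
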